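/- Let $S$ denote the shift $(Sx)_n=x_{n+1}$ on bi-infinite sequences. For $x\in\{1,3\}^{\mathbb Z}$ all of whose mono-symbol blocks (maximal constant runs) are finite of length $1$ or $3$, number the blocks from left to right by $\mathbb Z$, block $0$ being the one containing $x_0$. Then $x$ is called differentiable; its derivative $\Delta x\in\{1,3\}^{\mathbb Z}$ is the sequence of block lengths, and its recoding $\mathrm{rec}(x)\in\{A,B,C,D\}^{\mathbb Z}$ is obtained by encoding the blocks as $A=1$, $B=3$, $C=111$, $D=333$. The sequence $x$ is smooth if $\Delta^n x$ is differentiable for all $n\ge 0$. A sequence over $\{A,B,C,D\}$ has type $0$ if it contains $ABA$ or $DCD$, and type $1$ if it contains $BAB$ or $CDC$. For $\tau\in\{0,1\}^{\mathbb N}$ let $X_\tau$ be the set of smooth $x$ such that $\mathrm{rec}(\Delta^n x)$ has type $\tau_n$ for all $n\ge0$, and let $Y_\tau=\mathrm{rec}(X_\tau)$. A subshift is a nonempty closed set $Z$ of bi-infinite sequences with $S(Z)=Z$; it is minimal if it contains no subshift other than itself. The language $\mathcal L(Z)$ is the set of finite words occurring in elements of $Z$, and $[w]$ is the set of sequences in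 which $w$ occurs at position $0$. Let $\varphi_1$ be the substitution $A\mapsto B$, $B\mapsto C$, $C\mapsto BAB$, $D\mapsto CDC$, extended to bi-infinite sequences $y$ by concatenation, $\varphi_1(y_0)$ starting at position $0$. **Theorem.** For every $\tau\in\{0,1\}^{\mathbb N}$, $Y_\tau$ is a subshift, and $(Y_\tau,S)$ is minimal if and only if $\tau$ contains infinitely many $0$s. More precisely: 1. If $\tau$ contains infinitely many $0$s, then $\nu([w])>0$ for every $S$-invariant Borel probability measure $\nu$ on $Y_\tau$ and every $w\in\mathcal L(Y_\tau)$. 2. If $\tau$ contains only finitely many $0$s, then there is a word $w\in\mathcal L(Y_\tau)$ with $\nu([w])=0$ for every $S$-invariant Borel probability measure $\nu$ on $Y_\tau$. 3. For $\tau=1^\infty$, there is $\bar y\in Y_{1^\infty}$ with $S(\varphi_1(\bar y))=\bar y$ in which the letter $D$ occurs exactly once, at position $0$; and $\nu([D])=0$ for every $S$-invariant Borel probability measure $\nu$ on $Y_{1^\infty}$. -/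

import Mathlib

open MeasureTheory

namespace SmoothSeq

/-! ### Alphabets, shift, subshifts, invariant measures -/

/-- The alphabet `{1, 3}`. -/
inductive Sym
  | one
  | three
  deriving DecidableEq

/-- The integer denoted by a symbol of the alphabet `{1, 3}`. -/
def Sym.val : Sym → ℤ
  | Sym.one => 1
  | Sym.three => 3

/-- The recoding alphabet `{A, B, C, D}`. -/
inductive Letter
  | A
  | B
  | C
  | D
  deriving DecidableEq

/-- The discrete topology on the alphabet; `ℤ → Letter` then carries the product topology. -/
instance : TopologicalSpace Letter := ⊥

instance : DiscreteTopology Letter := ⟨rfl⟩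

/-- The discrete sigma-algebra on the alphabet; `ℤ → Letter` then carries the product
sigma-algebra, which is its Borel sigma-algebra. -/
instance : MeasurableSpace Letter := ⊤

/-- The shift `(S y) n = y (n + 1)` on bi-infinite sequences. -/
def shift {α : Type*} (y : ℤ → α) : ℤ → α := fun n => y (n + 1)

/-- A subshift: a nonempty closed set `Z` of bi-infinite sequences with `S(Z) = Z`. -/
def IsSubshift {α : Type*} [TopologicalSpace α] (Z : Set (ℤ → α)) : Prop :=
  Z.Nonempty ∧ IsClosed Z ∧ shift '' Z = Z

/-- A subshift is minimal if it contains no proper subshift. -/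
def IsMinimalSubshift {α : Type*} [TopologicalSpace α] (Z : Set (ℤ → α)) : Prop :=
  IsSubshift Z ∧ ∀ W : Set (ℤ → α), IsSubshift W → W ⊆ Z → W = Z

/-- The language of a set of bi-infinite sequences: the finite words that are factors of one of
its elements. -/
def language {α : Type*} (Z : Set (ℤ → α)) : Set (List α) :=
  {w | ∃ y ∈ Z, ∃ j : ℤ, ∀ i : Fin w.length, y (j + (i : ℕ)) = w.get i}

/-- The cylinder `[w]`: the sequences in which the word `w` occurs at position `0`. -/
def cylinder {α : Type*} (w : List α) : Set (ℤ → α) :=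
  {y | ∀ i : Fin w.length, y ((i : ℕ) : ℤ) = w.get i}

/-- `ν` is a shift-invariant Borel probability measure carried by the set `Z`. -/
def IsInvariantProbability (Z : Set (ℤ → Letter)) (ν : Measure (ℤ → Letter)) : Prop :=
  IsProbabilityMeasure ν ∧ ν Zᶜ = 0 ∧ MeasurePreserving shift ν ν

/-! ### Derivative, smooth sequences, recoding -/

/-- `s` enumerates, from left to right, the starting positions of the mono-symbol blocks of `x`,
the block of index `0` being the one that contains the position `0`. Such an `s` exists exactly
when all mono-symbol blocks of `x` are finite. -/
def IsRunStarts (x : ℤ → Sym) (s : ℤ → ℤ) : Prop :=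
  s 0 ≤ 0 ∧ 0 < s 1 ∧ ∀ k : ℤ, s k < s (k + 1) ∧
    (∀ i : ℤ, s k ≤ i → i < s (k + 1) → x i = x (s k)) ∧ x (s (k + 1)) ≠ x (s k)

/-- The enumeration of the block starts is unique. -/
theorem IsRunStarts.unique {x : ℤ → Sym} {s t : ℤ → ℤ} (hs : IsRunStarts x s)
    (ht : IsRunStarts x t) : s = t := by
  -- the position just before a block start carries the other symbol
  have bd : ∀ {u : ℤ → ℤ}, IsRunStarts x u → ∀ k, x (u k - 1) ≠ x (u k) := by
    intro u hu k
    obtain ⟨h1, h2, h3⟩ := hu.2.2 (k - 1)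
    rw [sub_add_cancel] at h1 h2 h3
    rw [h2 (u k - 1) (by omega) (by omega)]
    exact h3.symm
  -- a block start of one enumeration is not interior to a block of the other
  have key : ∀ {u v : ℤ → ℤ}, IsRunStarts x u → IsRunStarts x v → ∀ k l,
      u k < v l → u (k + 1) ≤ v l := by
    intro u v hu hv k l h
    by_contra hlt
    obtain ⟨h1, h2, h3⟩ := hu.2.2 k
    have e1 := h2 (v l) (by omega) (by omega)
    have e2 := h2 (v l - 1) (by omega) (by omega)
    exact bd hv l (e2.trans e1.symm)
  have step : ∀ k, s k = t k → s (k + 1) = t (k + 1) := by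
    intro k h
    have a := key hs ht k (k + 1) (by rw [h]; exact (ht.2.2 k).1)
    have b := key ht hs k (k + 1) (by rw [← h]; exact (hs.2.2 k).1)
    omega
  have stepd : ∀ k, s k = t k → s (k - 1) = t (k - 1) := by
    intro k h
    have a1 := (hs.2.2 (k - 1)).1
    have a2 := (ht.2.2 (k - 1)).1
    rcases lt_trichotomy (s (k - 1)) (t (k - 1)) with c | c | c
    · have := key hs ht (k - 1) (k - 1) c
      rw [sub_add_cancel] at *
      omega
    · exact c
    · have := key ht hs (k - 1) (k - 1) c
      rw [sub_add_cancel] at *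
      omega
  have zero : s 0 = t 0 := by
    have a1 := hs.1
    have a2 := ht.1
    have a3 := hs.2.1
    have a4 := ht.2.1
    rcases lt_trichotomy (s 0) (t 0) with c | c | c
    · have := key hs ht 0 0 c
      rw [zero_add] at this
      omega
    · exact c
    · have := key ht hs 0 0 c
      rw [zero_add] at this
      omega
  funext k
  induction k using Int.induction_on with
  | zero => exact zero
  | succ i ih => exact step _ ih
  | pred i ih => exact stepd _ ih

open Classical in
/-- The starting position of the `k`-th mono-symbol block of `x`, the block of index `0` being the
one that contains the position `0` (a junk value if some block of `x` is infinite). -/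
noncomputable def runStart (x : ℤ → Sym) : ℤ → ℤ :=
  if h : ∃ s, IsRunStarts x s then h.choose else 0

theorem runStart_eq {x : ℤ → Sym} {s : ℤ → ℤ} (hs : IsRunStarts x s) : runStart x = s := by
  have h : ∃ s, IsRunStarts x s := ⟨s, hs⟩
  rw [runStart, dif_pos h]
  exact h.choose_spec.unique hs

/-- The length of the `k`-th mono-symbol block of `x`. -/
noncomputable def runLength (x : ℤ → Sym) (k : ℤ) : ℤ := runStart x (k + 1) - runStart x k

/-- `x` is differentiable: all its mono-symbol blocks are finite, of length `1` or `3`. -/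
def IsDifferentiable (x : ℤ → Sym) : Prop :=
  (∃ s, IsRunStarts x s) ∧ ∀ k, runLength x k = 1 ∨ runLength x k = 3

/-- The derivative of a differentiable sequence `x`: the sequence of the lengths of its
mono-symbol blocks, the term of index `0` being the length of the block that contains `x 0`. -/
noncomputable def derivative (x : ℤ → Sym) : ℤ → Sym :=
  fun k => if runLength x k = 1 then Sym.one else Sym.three

/-- `x` is smooth: it is infinitely differentiable. -/
def IsSmooth (x : ℤ → Sym) : Prop := ∀ n : ℕ, IsDifferentiable (derivative^[n] x)

/-- The code of the mono-symbol block made of `ℓ` copies of the symbol `a`: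
`A = 1`, `B = 3`, `C = 111`, `D = 333`. -/
def code : (a ℓ : Sym) → Letter
  | Sym.one, Sym.one => Letter.A
  | Sym.three, Sym.one => Letter.B
  | Sym.one, Sym.three => Letter.C
  | Sym.three, Sym.three => Letter.D

/-- The recoding of a differentiable sequence `x`: its `k`-th term encodes the `k`-th
mono-symbol block of `x`. -/
noncomputable def recoding (x : ℤ → Sym) : ℤ → Letter :=
  fun k => code (x (runStart x k)) (derivative x k)

/-! ### Types and the subshifts `Y_τ` -/

/-- The word `a b c` occurs in `y`. -/
def Contains3 (y : ℤ → Letter) (a b c : Letter) : Prop :=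
  ∃ i : ℤ, y i = a ∧ y (i + 1) = b ∧ y (i + 2) = c

/-- `y` is of type `t`: type `0` means that `y` contains one of the blocks `ABA`, `DCD`,
type `1` that it contains one of the blocks `BAB`, `CDC`. -/
def HasType (y : ℤ → Letter) (t : Fin 2) : Prop :=
  if t = 0 then Contains3 y Letter.A Letter.B Letter.A ∨ Contains3 y Letter.D Letter.C Letter.D
  else Contains3 y Letter.B Letter.A Letter.B ∨ Contains3 y Letter.C Letter.D Letter.C

/-- `X_τ`: the smooth sequences `x` such that, for every `n`, the `n`-th derivative of `x` is of
type `τ n`. -/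
def X (τ : ℕ → Fin 2) : Set (ℤ → Sym) :=
  {x | IsSmooth x ∧ ∀ n : ℕ, HasType (recoding (derivative^[n] x)) (τ n)}

/-- `Y_τ`: the recodings of the elements of `X_τ`. -/
def Y (τ : ℕ → Fin 2) : Set (ℤ → Letter) := recoding '' X τ

/-! ### The substitutions -/

/-- The substitutions `φ₀` and `φ₁` on letters. -/
def subst (t : Fin 2) (a : Letter) : List Letter :=
  if t = 0 then
    match a with
    | Letter.A => [Letter.A]
    | Letter.B => [Letter.D]
    | Letter.C => [Letter.A, Letter.B, Letter.A]
    | Letter.D => [Letter.D, Letter.C, Letter.D]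
  else
    match a with
    | Letter.A => [Letter.B]
    | Letter.B => [Letter.C]
    | Letter.C => [Letter.B, Letter.A, Letter.B]
    | Letter.D => [Letter.C, Letter.D, Letter.C]

/-- `z = φ_t(y)`: the sequence `z` is the concatenation of the words `φ_t (y k)`, `k ∈ ℤ`, the
word `φ_t (y 0)` starting at position `0`; `c k` is the position where `φ_t (y k)` starts. -/
def IsSubstImage (t : Fin 2) (y z : ℤ → Letter) : Prop :=
  ∃ c : ℤ → ℤ, c 0 = 0 ∧ ∀ k : ℤ, c (k + 1) = c k + (subst t (y k)).length ∧
    ∀ i : Fin (subst t (y k)).length, z (c k + (i : ℕ)) = (subst t (y k)).get i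

end SmoothSeq

namespace SmoothSeq

/-! ### Letters as pairs of symbols -/

/-! A letter is a pair (symbol, length). The recoding `y` of `x` alternates in symbol, and its
lengths form the derivative of `x`. The blocks of the derivative therefore cut `y` into words of
constant length component and alternating symbol. These are the words `φ_t(a)`, where `a` encodes
the block, and `t` is the same for all blocks because their sizes are odd. The type of `y` reveals
`t`. Hence `Y τ` consists of the bottoms `y 0` of infinite towers in which `y n` is a shift of `φ_{τ
n}(y (n + 1))` (`mem_Y_iff`). The bottom determines the tower (`IsChain.unique`), and the towers
form a compact set, so `Y τ` is closed and nonempty.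

Infinitely many 0s: `φ₀` creates the letter `D` at its level, so every letter occurs at all levels
of every tower (`IsChain.exists_letter`). A word `φ_t(a)` and its two neighbouring letters depend
only on `a`, so any two towers share their three-letter words at every level; those expand to words
of unbounded length at level 0. Thus all elements of `Y τ` have the same words
(`IsChain.exists_word`), which gives minimality and positive measure of cylinders.

Only 1s from level `N` on: `φ₁` produces `D` only as the middle of `φ₁(D)`, so occurrences of `D`
move closer together as one goes up the tower, and level `N` contains at most one
(`IsChain.D_unique`). By compactness a long enough word of level 0 reveals this `D`. Such a word
eventually stops occurring, which contradicts minimality, and Poincaré recurrence makes its cylinder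
null. -/

/-- The other symbol. -/
def Sym.flip : Sym → Sym
  | Sym.one => Sym.three
  | Sym.three => Sym.one

@[simp] theorem Sym.flip_flip (s : Sym) : s.flip.flip = s := by cases s <;> rfl

theorem Sym.flip_ne (s : Sym) : s.flip ≠ s := by cases s <;> simp [Sym.flip]

theorem Sym.eq_flip_of_ne {s t : Sym} (h : s ≠ t) : s = t.flip := by
  cases s <;> cases t <;> simp_all [Sym.flip]

/-- The symbol of the block encoded by a letter. -/
def Letter.sym : Letter → Sym
  | .A => .one
  | .B => .three
  | .C => .one
  | .D => .three

/-- The length, as a symbol, of the block encoded by a letter. -/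
def Letter.len : Letter → Sym
  | .A => .one
  | .B => .one
  | .C => .three
  | .D => .three

@[simp] theorem code_sym_len (a : Letter) : code a.sym a.len = a := by cases a <;> rfl
@[simp] theorem sym_code (s l : Sym) : (code s l).sym = s := by cases s <;> cases l <;> rfl
@[simp] theorem len_code (s l : Sym) : (code s l).len = l := by cases s <;> cases l <;> rfl

theorem Letter.ext_sym_len {a b : Letter} (h : a.sym = b.sym) (h' : a.len = b.len) : a = b := by
  rw [← code_sym_len a, h, h', code_sym_len]

theorem Sym.val_eq (s : Sym) : s.val = 1 ∨ s.val = 3 := by cases s <;> simp [Sym.val]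

theorem Sym.val_pos (s : Sym) : 0 < s.val := by cases s <;> simp [Sym.val]

theorem Sym.val_odd (s : Sym) : Odd s.val := by
  cases s <;> simp only [Sym.val] <;> decide

/-- The symbol at distance `n` from `s` in an alternating sequence. -/
def alternate (s : Sym) (n : ℤ) : Sym := if Even n then s else s.flip

@[simp] theorem alternate_zero (s : Sym) : alternate s 0 = s := by simp [alternate]

theorem alternate_add_one (s : Sym) (n : ℤ) : alternate s (n + 1) = (alternate s n).flip := by
  unfold alternate
  by_cases h : Even n <;> simp [h]

theorem alternate_alternate (s : Sym) (m n : ℤ) :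
    alternate (alternate s m) n = alternate s (m + n) := by
  unfold alternate
  by_cases h : Even n <;> by_cases h' : Even m <;> simp [Int.even_add, h, h']

theorem alternate_of_odd (s : Sym) {n : ℤ} (h : Odd n) : alternate s n = s.flip := by
  simp [alternate, Int.not_even_iff_odd.2 h]

theorem alternate_of_even (s : Sym) {n : ℤ} (h : Even n) : alternate s n = s := by
  simp [alternate, h]

theorem alternate_flip (s : Sym) (n : ℤ) : alternate s.flip n = (alternate s n).flip := by
  unfold alternate
  split_ifs <;> simp

/-- The letters alternate between `{A, C}` and `{B, D}`. -/
def Alternating (v : ℤ → Letter) : Prop := ∀ k, (v (k + 1)).sym = (v k).sym.flip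

theorem Alternating.add {v : ℤ → Letter} (h : Alternating v) (k j : ℤ) :
    (v (k + j)).sym = alternate (v k).sym j := by
  induction j using Int.induction_on with
  | zero => simp
  | succ i ih => rw [← add_assoc, h, ih, alternate_add_one]
  | pred i ih =>
    have := h (k + (-(i : ℤ) - 1))
    rw [show k + (-(i : ℤ) - 1) + 1 = k + -i by ring, ih] at this
    have h2 := alternate_add_one (v k).sym (-(i : ℤ) - 1)
    rw [sub_add_cancel, this] at h2
    simpa using congrArg Sym.flip h2

theorem Alternating.exists_sym {v : ℤ → Letter} (h : Alternating v) (s : Sym) (k : ℤ) :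
    ∃ l, (l = k ∨ l = k + 1) ∧ (v l).sym = s := by
  by_cases hk : (v k).sym = s
  · exact ⟨k, .inl rfl, hk⟩
  · exact ⟨k + 1, .inr rfl, by rw [h, Sym.eq_flip_of_ne hk, Sym.flip_flip]⟩

/-- The `j`-th letter of `φ_t(a)`, for `a` a letter of symbol `s`. -/
def imageLetter (t : Fin 2) (s : Sym) (j : ℤ) : Letter := code (alternate s (((t : ℕ) : ℤ) + j)) s

/-- `u` is a shift of `φ_t(v)`: the word `φ_t (v k)` occurs in `u` at position `c k`, and the
position `0` lies in the word `φ_t (v 0)`. -/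
structure Parse (t : Fin 2) (u v : ℤ → Letter) (c : ℤ → ℤ) : Prop where
  zero : c 0 ≤ 0
  one : 0 < c 1
  step : ∀ k, c (k + 1) = c k + (v k).len.val
  letter : ∀ k j, 0 ≤ j → j < (v k).len.val → u (c k + j) = imageLetter t (v k).sym j

/-! ### Partitions of the integers into intervals -/

theorem le_of_step {c : ℤ → ℤ} (h : ∀ k, c k < c (k + 1)) (k : ℤ) (m : ℕ) :
    c k + m ≤ c (k + m) := by
  induction m with
  | zero => simp
  | succ m ih =>
    have := h (k + m)
    push_cast
    rw [← add_assoc k]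
    omega

theorem step_le_sub {c : ℤ → ℤ} (h : ∀ k, c k < c (k + 1)) {k l : ℤ} (hkl : k ≤ l) :
    l - k ≤ c l - c k := by
  obtain ⟨m, rfl⟩ := Int.le.dest hkl
  have := le_of_step h k m
  omega

theorem strictMono_of_step {c : ℤ → ℤ} (h : ∀ k, c k < c (k + 1)) : StrictMono c := by
  intro a b hab
  have := step_le_sub h hab.le
  omega

theorem exists_block {c : ℤ → ℤ} (h : ∀ k, c k < c (k + 1)) (p : ℤ) :
    ∃ k, c k ≤ p ∧ p < c (k + 1) := by
  have hb : ∃ b, ∀ z, c z ≤ p → z ≤ b := by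
    refine ⟨max 0 (p - c 0), fun z hz => ?_⟩
    by_contra hlt
    push Not at hlt
    have := step_le_sub h (show 0 ≤ z by omega)
    omega
  have he : ∃ z, c z ≤ p := by
    refine ⟨min 0 (p - c 0), ?_⟩
    have := step_le_sub h (show min 0 (p - c 0) ≤ 0 by omega)
    omega
  obtain ⟨k, hk, hm⟩ := Int.exists_greatest_of_bdd hb he
  refine ⟨k, hk, ?_⟩
  by_contra hlt
  have := hm (k + 1) (by omega)
  omega

theorem block_unique {c : ℤ → ℤ} (h : ∀ k, c k < c (k + 1)) {p k l : ℤ} (hk : c k ≤ p)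
    (hk' : p < c (k + 1)) (hl : c l ≤ p) (hl' : p < c (l + 1)) : k = l := by
  have hm := strictMono_of_step h
  have h1 : k < l + 1 := hm.lt_iff_lt.1 (by omega)
  have h2 : l < k + 1 := hm.lt_iff_lt.1 (by omega)
  omega

theorem exists_steps (f : ℤ → ℤ) (a : ℤ) : ∃ c : ℤ → ℤ, c 0 = a ∧ ∀ k, c (k + 1) = c k + f k := by
  refine ⟨fun k => a + ∑ i ∈ Finset.Ico 0 k, f i - ∑ i ∈ Finset.Ico k 0, f i, by simp, ?_⟩
  intro k
  rcases lt_or_ge k 0 with hk | hk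
  · have h1 : Finset.Ico 0 (k + 1) = ∅ := Finset.Ico_eq_empty (by omega)
    have h2 : Finset.Ico 0 k = ∅ := Finset.Ico_eq_empty (by omega)
    have h3 : Finset.Ico k 0 = insert k (Finset.Ico (k + 1) 0) := by
      ext i; simp only [Finset.mem_Ico, Finset.mem_insert]; omega
    simp only [h1, h2, h3]
    rw [Finset.sum_insert (by simp)]
    ring
  · have h1 : Finset.Ico (k + 1) 0 = ∅ := Finset.Ico_eq_empty (by omega)
    have h2 : Finset.Ico k 0 = ∅ := Finset.Ico_eq_empty (by omega)
    have h3 : Finset.Ico 0 (k + 1) = insert k (Finset.Ico 0 k) := by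
      ext i; simp only [Finset.mem_Ico, Finset.mem_insert]; omega
    simp only [h1, h2, h3]
    rw [Finset.sum_insert (by simp)]
    ring

/-- A sequence prescribed on each interval of a partition. -/
theorem exists_piecewise {α : Type*} {c : ℤ → ℤ} (h : ∀ k, c k < c (k + 1)) (g : ℤ → ℤ → α) :
    ∃ u : ℤ → α, ∀ k j, 0 ≤ j → c k + j < c (k + 1) → u (c k + j) = g k j := by
  choose b hb using exists_block h
  refine ⟨fun p => g (b p) (p - c (b p)), fun k j hj hj' => ?_⟩
  have : b (c k + j) = k :=
    block_unique h (hb _).1 (hb _).2 (by omega) hj'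
  simp [this]

theorem Parse.lt {t : Fin 2} {u v : ℤ → Letter} {c : ℤ → ℤ} (h : Parse t u v c) (k : ℤ) :
    c k < c (k + 1) := by
  have := h.step k
  have := (v k).len.val_pos
  omega

theorem Parse.eq_of_mem {t : Fin 2} {u v : ℤ → Letter} {c : ℤ → ℤ} (h : Parse t u v c) {k i : ℤ}
    (h1 : c k ≤ i) (h2 : i < c (k + 1)) : u i = imageLetter t (v k).sym (i - c k) := by
  have := h.step k
  have h3 := h.letter k (i - c k) (by omega) (by omega)
  rwa [add_sub_cancel] at h3

/-! ### Sequences with a given recoding -/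

/-- The blocks of `x` are encoded by `y` and start at the positions `s k`. -/
structure Codes (x : ℤ → Sym) (s : ℤ → ℤ) (y : ℤ → Letter) : Prop where
  starts : IsRunStarts x s
  step : ∀ k, s (k + 1) = s k + (y k).len.val
  sym : ∀ k, x (s k) = (y k).sym

theorem Codes.runStart {x : ℤ → Sym} {s : ℤ → ℤ} {y : ℤ → Letter} (h : Codes x s y) :
    runStart x = s := runStart_eq h.starts

theorem Codes.derivative {x : ℤ → Sym} {s : ℤ → ℤ} {y : ℤ → Letter} (h : Codes x s y) :
    derivative x = fun k => (y k).len := by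
  funext k
  unfold SmoothSeq.derivative runLength
  rw [h.runStart, h.step]
  cases (y k).len <;> simp [Sym.val]

theorem Codes.recoding {x : ℤ → Sym} {s : ℤ → ℤ} {y : ℤ → Letter} (h : Codes x s y) :
    recoding x = y := by
  funext k
  unfold SmoothSeq.recoding
  rw [h.derivative, h.runStart, h.sym, code_sym_len]

theorem Codes.isDifferentiable {x : ℤ → Sym} {s : ℤ → ℤ} {y : ℤ → Letter} (h : Codes x s y) :
    IsDifferentiable x := by
  refine ⟨⟨s, h.starts⟩, fun k => ?_⟩
  unfold runLength
  rw [h.runStart, h.step]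
  simpa using (y k).len.val_eq

theorem Codes.alternating {x : ℤ → Sym} {s : ℤ → ℤ} {y : ℤ → Letter} (h : Codes x s y) :
    Alternating y := fun k => by
  rw [← h.sym, ← h.sym]
  exact Sym.eq_flip_of_ne (h.starts.2.2 k).2.2

theorem IsDifferentiable.codes {x : ℤ → Sym} (h : IsDifferentiable x) :
    Codes x (runStart x) (recoding x) := by
  obtain ⟨⟨s, hs⟩, hl⟩ := h
  have hr := runStart_eq hs
  refine ⟨hr ▸ hs, fun k => ?_, fun k => by simp [recoding]⟩
  have := hl k
  simp only [recoding, len_code, derivative]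
  unfold runLength at this ⊢
  split_ifs with h
  · simp only [Sym.val]; omega
  · simp only [Sym.val]; omega

theorem Alternating.exists_codes {y : ℤ → Letter} (h : Alternating y) : ∃ x s, Codes x s y := by
  obtain ⟨s, h0, hs⟩ := exists_steps (fun k => (y k).len.val) 0
  have hlt : ∀ k, s k < s (k + 1) := fun k => by
    have := (y k).len.val_pos
    rw [hs]; omega
  obtain ⟨x, hx⟩ := exists_piecewise hlt (fun k _ => (y k).sym)
  have hsym : ∀ k, x (s k) = (y k).sym := fun k => by simpa using hx k 0 le_rfl (by simpa using hlt k)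
  refine ⟨x, s, ⟨h0.le, by simpa [h0] using hlt 0, fun k => ⟨hlt k, fun i hi hi' => ?_, ?_⟩⟩, hs, hsym⟩
  · rw [hsym]
    simpa using hx k (i - s k) (by omega) (by omega)
  · rw [hsym, hsym, h]
    exact Sym.flip_ne _

/-- All letters of `φ_t(a)` have length `a.sym`, and consecutive letters of `v` have opposite
symbols, so the words of the parse are exactly the maximal blocks of the length sequence of `u`. -/
theorem Parse.codes {t : Fin 2} {u v : ℤ → Letter} {c : ℤ → ℤ} (h : Parse t u v c)
    (hv : Alternating v) : Codes (fun k => (u k).len) c v := by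
  have hsym : ∀ k i, c k ≤ i → i < c (k + 1) → (u i).len = (v k).sym := fun k i hi hi' => by
    rw [h.eq_of_mem hi hi', imageLetter, len_code]
  refine ⟨⟨h.zero, h.one, fun k => ⟨h.lt k, fun i hi hi' => ?_, ?_⟩⟩, h.step,
    fun k => hsym k _ le_rfl (h.lt k)⟩
  · beta_reduce
    rw [hsym k i hi hi', hsym k _ le_rfl (h.lt k)]
  · beta_reduce
    rw [hsym k _ le_rfl (h.lt k), hsym _ _ le_rfl (h.lt (k + 1)), hv]
    exact Sym.flip_ne _

/-- Desubstitution is deterministic: `v` is the recoding of the length sequence of `u`, whatever the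
substitution. -/
theorem Parse.right_unique {t t' : Fin 2} {u v v' : ℤ → Letter} {c c' : ℤ → ℤ}
    (h : Parse t u v c) (h' : Parse t' u v' c') (hv : Alternating v) (hv' : Alternating v') :
    v = v' := by
  rw [← (h.codes hv).recoding, (h'.codes hv').recoding]

/-- Consecutive recodings are related by one of the substitutions. -/
theorem Codes.exists_parse {x : ℤ → Sym} {s c : ℤ → ℤ} {y z : ℤ → Letter} (h : Codes x s y)
    (h' : Codes (SmoothSeq.derivative x) c z) : ∃ t, Parse t y z c := by
  rw [h.derivative] at h'
  have hz := h'.alternating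
  have hy := h.alternating
  -- Blocks have odd size, so the symbol of `y` at block starts flips from block to block, as does
  -- the symbol of `z`; the offset `t` seen at block 0 is the same everywhere.
  have hc : ∀ t : Fin 2, (y (c 0)).sym = alternate (z 0).sym (t : ℕ) →
      ∀ k, (y (c k)).sym = alternate (z k).sym (t : ℕ) := by
    intro t h0 k
    have step : ∀ k, (y (c (k + 1))).sym = (y (c k)).sym.flip := fun k => by
      rw [h'.step, hy.add, alternate_of_odd _ (Sym.val_odd _)]
    induction k using Int.induction_on with
    | zero => exact h0
    | succ i ih => rw [step, ih, hz, alternate_flip]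
    | pred i ih =>
      have h1 := step (-i - 1)
      have h2 := hz (-i - 1)
      rw [sub_add_cancel] at h1 h2
      rw [ih, h2, alternate_flip] at h1
      simpa using (congrArg Sym.flip h1).symm
  have : ∃ t : Fin 2, (y (c 0)).sym = alternate (z 0).sym (t : ℕ) := by
    by_cases h0 : (y (c 0)).sym = (z 0).sym
    · exact ⟨0, by simpa using h0⟩
    · exact ⟨1, by rw [alternate_of_odd _ (by simp)]; exact Sym.eq_flip_of_ne h0⟩
  obtain ⟨t, ht⟩ := this
  refine ⟨t, h'.starts.1, h'.starts.2.1, h'.step, fun k j hj hj' => ?_⟩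
  refine Letter.ext_sym_len ?_ ?_
  · rw [hy.add, hc t ht k, alternate_alternate, imageLetter, sym_code]
  · rw [imageLetter, len_code, ← h'.sym k]
    exact (h'.starts.2.2 k).2.1 (c k + j) (by omega) (by rw [h'.step]; omega)

/-! ### Types -/

theorem Parse.hasType {t : Fin 2} {u v : ℤ → Letter} {c : ℤ → ℤ} (h : Parse t u v c)
    (hv : ∃ k, (v k).len = Sym.three) : HasType u t := by
  obtain ⟨k, hk⟩ := hv
  have h0 := h.letter k 0 le_rfl (by simp [hk, Sym.val])
  have h1 := h.letter k 1 (by norm_num) (by simp [hk, Sym.val])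
  have h2 := h.letter k 2 (by norm_num) (by simp [hk, Sym.val])
  rw [add_zero] at h0
  unfold HasType Contains3
  fin_cases t <;> cases hs : (v k).sym <;> rw [hs] at h0 h1 h2 <;>
    simp [imageLetter, alternate, code, Sym.flip] at h0 h1 h2 ⊢
  · exact .inl ⟨_, h0, h1, h2⟩
  · exact .inr ⟨_, h0, h1, h2⟩
  · exact .inl ⟨_, h0, h1, by rw [h2]; rfl⟩
  · exact .inr ⟨_, h0, h1, by rw [h2]; rfl⟩

theorem Parse.mem_same_block {t : Fin 2} {u v : ℤ → Letter} {c : ℤ → ℤ} (h : Parse t u v c)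
    (hv : Alternating v) {i k : ℤ} (h1 : c k ≤ i) (h2 : i < c (k + 1))
    (h3 : (u i).len = (u (i + 1)).len) : i + 1 < c (k + 1) := by
  by_contra hlt
  have e : i + 1 = c (k + 1) := by omega
  have hc := h.codes hv
  have a := hc.starts.2.2 k
  have b := a.2.1 i h1 h2
  simp only at a b
  rw [e] at h3
  exact a.2.2 (h3.symm.trans b)

/-- The three letters of `ABA`, `DCD`, `BAB` or `CDC` have equal length, so they lie in one word of
the parse and fill it; the symbol of the first one then determines `t`. -/
theorem Parse.type_eq {t t' : Fin 2} {u v : ℤ → Letter} {c : ℤ → ℤ} (h : Parse t u v c)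
    (hv : Alternating v) (hu : HasType u t') : t' = t := by
  have key : ∀ a b : Letter, a.len = b.len → Contains3 u a b a →
      a.sym = alternate a.len (t : ℕ) := by
    rintro a b hab ⟨i, h0, h1, h2⟩
    obtain ⟨k, hk, hk'⟩ := exists_block h.lt i
    have i1 := h.mem_same_block hv hk hk' (by rw [h0, h1, hab])
    have i2 := h.mem_same_block hv (by omega) i1 (by rw [h1, add_assoc, one_add_one_eq_two, h2, hab])
    have e : i = c k := by
      have := h.step k
      have := (v k).len.val_eq
      omega
    have := h.eq_of_mem hk hk'
    rw [h0, e, sub_self, imageLetter, add_zero] at this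
    rw [this, sym_code, len_code]
  unfold HasType at hu
  have h01 : t = 0 ∨ t = 1 := by omega
  have h01' : t' = 0 ∨ t' = 1 := by omega
  rcases h01' with rfl | rfl <;> rcases h01 with rfl | rfl <;> simp at hu ⊢ <;>
  · rcases hu with hu | hu
    · have := key _ _ (by rfl) hu
      revert this
      simp [Letter.sym, Letter.len, alternate, Sym.flip]
    · have := key _ _ (by rfl) hu
      revert this
      simp [Letter.sym, Letter.len, alternate, Sym.flip]

/-! ### Chains of desubstitutions -/

/-- A chain of desubstitutions directed by `τ`. -/
def IsChain (τ : ℕ → Fin 2) (y : ℕ → ℤ → Letter) (c : ℕ → ℤ → ℤ) : Prop :=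
  (∀ n, Alternating (y n)) ∧ ∀ n, Parse (τ n) (y n) (y (n + 1)) (c n)

theorem IsChain.unique {τ τ' : ℕ → Fin 2} {y y' : ℕ → ℤ → Letter} {c c' : ℕ → ℤ → ℤ}
    (h : IsChain τ y c) (h' : IsChain τ' y' c') (h0 : y 0 = y' 0) : y = y' := by
  funext n
  induction n with
  | zero => exact h0
  | succ n ih =>
    have := h'.2 n
    rw [← ih] at this
    exact (h.2 n).right_unique this (h.1 _) (h'.1 _)

/-- Symbols at level `n + 1` are lengths at level `n`, and one of any two consecutive letters has
symbol three. -/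
theorem IsChain.exists_long {τ : ℕ → Fin 2} {y : ℕ → ℤ → Letter} {c : ℕ → ℤ → ℤ}
    (h : IsChain τ y c) (n : ℕ) (k : ℤ) :
    ∃ l, c n k ≤ l ∧ l < c n (k + 2) ∧ (y n l).len = Sym.three := by
  obtain ⟨l, hl, hs⟩ := (h.1 (n + 1)).exists_sym Sym.three k
  have h1 := (h.2 n).lt k
  have h2 := (h.2 n).lt (k + 1)
  rw [add_assoc] at h2
  refine ⟨c n l, ?_, ?_, by simpa [hs] using ((h.2 n).codes (h.1 _)).sym l⟩
  · rcases hl with rfl | rfl <;> omega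
  · rcases hl with rfl | rfl <;> norm_num at * <;> omega

/-- Conversely, any alternating bottom is the recoding of some `x`, and `Parse.codes` propagates up
the tower. Long letters at each level make the prescribed types actually occur. -/
theorem mem_Y_iff {τ : ℕ → Fin 2} {z : ℤ → Letter} :
    z ∈ Y τ ↔ ∃ y c, IsChain τ y c ∧ y 0 = z := by
  constructor
  · rintro ⟨x, ⟨hs, ht⟩, rfl⟩
    have hc := fun n => (hs n).codes
    refine ⟨fun n => recoding (derivative^[n] x), fun n => runStart (derivative^[n + 1] x),
      ⟨fun n => (hc n).alternating, fun n => ?_⟩, rfl⟩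
    have h1 := hc (n + 1)
    beta_reduce
    rw [Function.iterate_succ_apply'] at h1 ⊢
    obtain ⟨t, h2⟩ := (hc n).exists_parse h1
    rw [h2.type_eq h1.alternating (ht n)]
    exact h2
  · rintro ⟨y, c, h, rfl⟩
    obtain ⟨x, s, hx⟩ := (h.1 0).exists_codes
    have hd : ∀ n, ∃ s, Codes (derivative^[n] x) s (y n) := by
      intro n
      induction n with
      | zero => exact ⟨s, hx⟩
      | succ n ih =>
        obtain ⟨s, hs⟩ := ih
        refine ⟨c n, ?_⟩
        rw [Function.iterate_succ_apply', hs.derivative]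
        exact (h.2 n).codes (h.1 _)
    refine ⟨x, ⟨fun n => ?_, fun n => ?_⟩, hx.recoding⟩
    · obtain ⟨s, hs⟩ := hd n
      exact hs.isDifferentiable
    · obtain ⟨s, hs⟩ := hd n
      rw [hs.recoding]
      obtain ⟨l, -, -, hl⟩ := h.exists_long (n + 1) 0
      exact (h.2 n).hasType ⟨l, hl⟩

/-! ### Shifting chains -/

/-- The index of the block containing `p`, level by level. -/
theorem IsChain.exists_indices {τ : ℕ → Fin 2} {y : ℕ → ℤ → Letter} {c : ℕ → ℤ → ℤ}
    (h : IsChain τ y c) (p : ℤ) :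
    ∃ q : ℕ → ℤ, q 0 = p ∧ ∀ n, c n (q (n + 1)) ≤ q n ∧ q n < c n (q (n + 1) + 1) := by
  choose b hb using fun n => exists_block (h.2 n).lt
  exact ⟨fun n => Nat.rec p (fun n r => b n r) n, rfl, fun n => hb n _⟩

theorem IsChain.translate {τ : ℕ → Fin 2} {y : ℕ → ℤ → Letter} {c : ℕ → ℤ → ℤ}
    (h : IsChain τ y c) {q : ℕ → ℤ}
    (hq : ∀ n, c n (q (n + 1)) ≤ q n ∧ q n < c n (q (n + 1) + 1)) :
    IsChain τ (fun n i => y n (q n + i)) (fun n k => c n (q (n + 1) + k) - q n) := by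
  refine ⟨fun n k => ?_, fun n => ⟨?_, ?_, fun k => ?_, fun k j hj hj' => ?_⟩⟩
  · beta_reduce
    rw [← add_assoc]
    exact h.1 n _
  · have := (hq n).1
    beta_reduce
    rw [add_zero]
    omega
  · have := (hq n).2
    beta_reduce
    omega
  · beta_reduce
    rw [← add_assoc, (h.2 n).step]
    ring
  · rw [← (h.2 n).letter _ _ hj hj']
    beta_reduce
    congr 1
    ring

theorem translate_mem_Y {τ : ℕ → Fin 2} {z : ℤ → Letter} (h : z ∈ Y τ) (p : ℤ) :
    (fun i => z (p + i)) ∈ Y τ := by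
  obtain ⟨y, c, hc, rfl⟩ := mem_Y_iff.1 h
  obtain ⟨q, h0, hq⟩ := hc.exists_indices p
  exact mem_Y_iff.2 ⟨_, _, hc.translate hq, by simp [h0]⟩

/-! ### Compactness -/

/-- Needed because a parse reads `u` at the position `c k + j`, which varies with the data. -/
theorem continuous_eval_int {X α : Type*} [TopologicalSpace X] [TopologicalSpace α]
    {f : X → ℤ → α} {g : X → ℤ} (hf : Continuous f) (hg : Continuous g) :
    Continuous fun x => f x (g x) := by
  have : Continuous fun p : (ℤ → α) × ℤ => p.1 p.2 :=
    continuous_prod_of_discrete_right.2 fun i => continuous_apply i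
  exact this.comp (hf.prodMk hg)

instance : Finite Letter := by
  refine Finite.of_injective (fun a : Letter => (decide (a.sym = .one), decide (a.len = .one))) ?_
  intro a b
  cases a <;> cases b <;> simp [Letter.sym, Letter.len]

/-- Pairs consisting of a sequence of sequences of letters and a sequence of block positions. -/
abbrev ChainData := (ℕ → ℤ → Letter) × (ℕ → ℤ → ℤ)

theorem continuous_letter (n : ℕ) (k : ℤ) : Continuous fun p : ChainData => p.1 n k :=
  (continuous_apply k).comp ((continuous_apply n).comp continuous_fst)

theorem continuous_position (n : ℕ) (k : ℤ) : Continuous fun p : ChainData => p.2 n k :=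
  (continuous_apply k).comp ((continuous_apply n).comp continuous_snd)

theorem isClosed_setOf_discrete {X α : Type*} [TopologicalSpace X] [TopologicalSpace α]
    [DiscreteTopology α] {f : X → α} (hf : Continuous f) (P : α → Prop) :
    IsClosed {x | P (f x)} :=
  (isClosed_discrete {a | P a}).preimage hf

theorem isClosed_alternating (n : ℕ) : IsClosed {p : ChainData | Alternating (p.1 n)} := by
  simp only [Alternating, Set.ofPred_forall]
  exact isClosed_iInter fun k => isClosed_setOf_discrete
    ((continuous_letter n (k + 1)).prodMk (continuous_letter n k)) fun a => a.1.sym = a.2.sym.flip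

theorem isClosed_parse (t : Fin 2) (n m : ℕ) :
    IsClosed {p : ChainData | Parse t (p.1 n) (p.1 m) (p.2 n)} := by
  have : {p : ChainData | Parse t (p.1 n) (p.1 m) (p.2 n)} =
      {p | p.2 n 0 ≤ 0} ∩ {p | 0 < p.2 n 1} ∩
      (⋂ k, {p | p.2 n (k + 1) = p.2 n k + (p.1 m k).len.val}) ∩
      (⋂ (k : ℤ) (j : ℤ), {p | 0 ≤ j → j < (p.1 m k).len.val →
        p.1 n (p.2 n k + j) = imageLetter t (p.1 m k).sym j}) := by
    ext p
    simp only [Set.mem_ofPred_eq, Set.mem_inter_iff, Set.mem_iInter]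
    exact ⟨fun h => ⟨⟨⟨h.1, h.2⟩, h.3⟩, h.4⟩, fun h => ⟨h.1.1.1, h.1.1.2, h.1.2, h.2⟩⟩
  rw [this]
  refine (((isClosed_setOf_discrete (continuous_position n 0) (· ≤ 0)).inter
    (isClosed_setOf_discrete (continuous_position n 1) (0 < ·))).inter
    (isClosed_iInter fun k => ?_)).inter (isClosed_iInter fun k => isClosed_iInter fun j => ?_)
  · exact isClosed_setOf_discrete ((continuous_position n (k + 1)).prodMk
      ((continuous_position n k).prodMk (continuous_letter m k)))
      fun a => a.1 = a.2.1 + a.2.2.len.val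
  · exact isClosed_setOf_discrete ((continuous_letter m k).prodMk (continuous_eval_int
      ((continuous_apply n).comp continuous_fst) ((continuous_position n k).add continuous_const)))
      fun a => 0 ≤ j → j < a.1.len.val → a.2 = imageLetter t a.1.sym j

theorem isClosed_setOf_isChain (τ : ℕ → Fin 2) : IsClosed {p : ChainData | IsChain τ p.1 p.2} := by
  simp only [IsChain, Set.ofPred_and, Set.ofPred_forall]
  exact (isClosed_iInter isClosed_alternating).inter
    (isClosed_iInter fun n => isClosed_parse (τ n) n (n + 1))

/-- A compact set of chain data, containing all chains. -/
def boundedData : Set ChainData :=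
  {p | ∀ n k, p.2 n k ∈ Set.Icc (-(3 * |k| + 3)) (3 * |k| + 3)}

theorem isCompact_boundedData : IsCompact boundedData := by
  have h : IsCompact {c : ℕ → ℤ → ℤ | ∀ n, c n ∈ {d : ℤ → ℤ |
      ∀ k, d k ∈ Set.Icc (-(3 * |k| + 3)) (3 * |k| + 3)}} :=
    isCompact_pi_infinite fun n => isCompact_pi_infinite fun k => (Set.finite_Icc _ _).isCompact
  have := (isCompact_univ (X := ℕ → ℤ → Letter)).prod h
  convert this using 1
  ext p
  simp [boundedData]

/-- Block 0 contains the origin and every block has size at most 3. This confines the cut points to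
finite sets and makes the space of towers compact. -/
theorem Parse.bounded {t : Fin 2} {u v : ℤ → Letter} {c : ℤ → ℤ} (h : Parse t u v c) (k : ℤ) :
    c k ∈ Set.Icc (-(3 * |k| + 3)) (3 * |k| + 3) := by
  have h0 := h.zero
  have h1 := h.one
  have hs := fun k => h.step k
  have hl := fun k => (v k).len.val_eq
  have hs0 := hs 0
  rw [zero_add] at hs0
  have hl0 := hl 0
  induction k using Int.induction_on with
  | zero => simp only [Set.mem_Icc, abs_zero]; omega
  | succ i ih =>
    have a := hs i
    have b := hl i
    simp only [Set.mem_Icc] at ih ⊢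
    rw [abs_of_nonneg (by omega)] at ih ⊢
    omega
  | pred i ih =>
    have a := hs (-i - 1)
    have b := hl (-i - 1)
    rw [sub_add_cancel] at a
    simp only [Set.mem_Icc] at ih ⊢
    rw [abs_of_nonpos (by omega)] at ih ⊢
    omega

theorem IsChain.mem_boundedData {τ : ℕ → Fin 2} {y : ℕ → ℤ → Letter} {c : ℕ → ℤ → ℤ}
    (h : IsChain τ y c) : (y, c) ∈ boundedData := fun n k => (h.2 n).bounded k

/-- The elements of `Y_τ` whose `N`-th desubstitution has the letter `a` at position `0`. -/
def levelCylinder (τ : ℕ → Fin 2) (N : ℕ) (a : Letter) : Set (ℤ → Letter) :=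
  {z | ∃ y c, IsChain τ y c ∧ y 0 = z ∧ y N 0 = a}

theorem isClosed_levelCylinder (τ : ℕ → Fin 2) (N : ℕ) (a : Letter) :
    IsClosed (levelCylinder τ N a) := by
  have h : IsCompact ({p : ChainData | IsChain τ p.1 p.2} ∩ {p | p.1 N 0 = a}) :=
    isCompact_boundedData.of_isClosed_subset ((isClosed_setOf_isChain τ).inter
      (isClosed_setOf_discrete (continuous_letter N 0) (· = a)))
      fun p hp => IsChain.mem_boundedData hp.1
  have h2 := h.image ((continuous_apply 0).comp continuous_fst :
    Continuous fun p : ChainData => p.1 0)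
  convert h2.isClosed using 1
  ext z
  constructor
  · rintro ⟨y, c, hc, h0, hN⟩
    exact ⟨(y, c), ⟨hc, hN⟩, h0⟩
  · rintro ⟨p, ⟨hc, hN⟩, h0⟩
    exact ⟨p.1, p.2, hc, h0, hN⟩

theorem Y_eq_iUnion_levelCylinder (τ : ℕ → Fin 2) (N : ℕ) : Y τ = ⋃ a, levelCylinder τ N a := by
  ext z
  simp only [mem_Y_iff, levelCylinder, Set.mem_iUnion, Set.mem_ofPred_eq]
  constructor
  · rintro ⟨y, c, h, h0⟩
    exact ⟨_, y, c, h, h0, rfl⟩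
  · rintro ⟨_, y, c, h, h0, -⟩
    exact ⟨y, c, h, h0⟩

theorem isClosed_Y (τ : ℕ → Fin 2) : IsClosed (Y τ) := by
  rw [Y_eq_iUnion_levelCylinder τ 0]
  exact isClosed_iUnion_of_finite fun a => isClosed_levelCylinder τ 0 a

/-! ### Existence of chains -/

theorem Alternating.exists_parse {v : ℤ → Letter} (hv : Alternating v) (t : Fin 2) {a : ℤ}
    (ha : a ≤ 0) (ha' : 0 < a + (v 0).len.val) :
    ∃ u c, Parse t u v c ∧ c 0 = a ∧ Alternating u := by
  obtain ⟨c, h0, hc⟩ := exists_steps (fun k => (v k).len.val) a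
  have hlt : ∀ k, c k < c (k + 1) := fun k => by
    have := (v k).len.val_pos
    rw [hc]; omega
  obtain ⟨u, hu⟩ := exists_piecewise hlt (fun k j => imageLetter t (v k).sym j)
  have hp : Parse t u v c := by
    refine ⟨by omega, ?_, hc, fun k j hj hj' => hu k j hj (by rw [hc]; omega)⟩
    have := hc 0
    rw [zero_add] at this
    omega
  refine ⟨u, c, hp, h0, fun i => ?_⟩
  obtain ⟨k, hk, hk'⟩ := exists_block hlt i
  rw [hp.eq_of_mem hk hk']
  by_cases hi : i + 1 < c (k + 1)
  · rw [hp.eq_of_mem (by omega) hi]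
    simp only [imageLetter, sym_code]
    rw [show i + 1 - c k = i - c k + 1 by ring, ← add_assoc, alternate_add_one]
  · have e : i + 1 = c (k + 1) := by omega
    rw [hp.eq_of_mem (k := k + 1) e.ge (by rw [e]; exact hlt _)]
    -- Across a cut: the word has odd size, so its last symbol equals its first, and the next word
    -- starts with the flipped symbol.
    have ho : i - c k = (v k).len.val - 1 := by rw [← sub_eq_zero] at e ⊢; rw [← e, hc]; ring
    have he : Even ((v k).len.val - 1) := (Sym.val_odd _).sub_odd odd_one
    simp only [imageLetter, sym_code]
    rw [e, sub_self, add_zero, hv, alternate_flip, ho, ← alternate_alternate,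
      alternate_of_even _ he]

theorem exists_alternating : ∃ v : ℤ → Letter, Alternating v ∧ v 0 = .D := by
  refine ⟨fun k => code (alternate .three k) .three, fun k => ?_, by simp [code]⟩
  simp [alternate_add_one]

theorem exists_partial_chain (n : ℕ) : ∀ τ : ℕ → Fin 2, ∃ p ∈ boundedData,
    (∀ j, Alternating (p.1 j)) ∧ (∀ j, p.1 j 0 = .D) ∧
    ∀ j < n, Parse (τ j) (p.1 j) (p.1 (j + 1)) (p.2 j) ∧ p.2 j 0 = -((τ j : ℕ) : ℤ) := by
  induction n with
  | zero =>
    intro τ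
    obtain ⟨v, hv, h0⟩ := exists_alternating
    refine ⟨(fun _ => v, fun _ _ => 0), fun n k => ?_, fun _ => hv, fun _ => h0, by simp⟩
    have := abs_nonneg k
    simp only [Set.mem_Icc]
    omega
  | succ n ih =>
    intro τ
    obtain ⟨⟨y, c⟩, hb, ha, hD, hp⟩ := ih fun n => τ (n + 1)
    simp only at ha hD hp
    have h01 : ((τ 0 : ℕ) : ℤ) = 0 ∨ ((τ 0 : ℕ) : ℤ) = 1 := by omega
    -- `D` has index `t` in `φ_t(D)` (`DCD` or `CDC`), so cutting at `-t` puts it at the origin.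
    obtain ⟨u, d, hu, hd, hua⟩ := (ha 0).exists_parse (τ 0) (a := -((τ 0 : ℕ) : ℤ)) (by omega)
      (by rw [hD]; simp only [Letter.len, Sym.val]; omega)
    refine ⟨(fun j => Nat.casesOn j u y, fun j => Nat.casesOn j d c), ?_, ?_, ?_, ?_⟩
    · rintro (_ | j) k
      · exact hu.bounded k
      · exact hb j k
    · rintro (_ | j)
      · exact hua
      · exact ha j
    · rintro (_ | j)
      · have := hu.eq_of_mem (k := 0) (i := 0) hu.zero (by simpa using hu.one)
        rw [hD, hd] at this
        rw [imageLetter, zero_sub, neg_neg, alternate_of_even _ ⟨_, rfl⟩] at this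
        exact this
      · exact hD j
    · rintro (_ | j) hj
      · exact ⟨hu, hd⟩
      · exact hp j (by omega)

theorem exists_chain (τ : ℕ → Fin 2) : ∃ y c, IsChain τ y c ∧ (∀ n, y n 0 = .D) ∧
    ∀ n, c n 0 = -((τ n : ℕ) : ℤ) := by
  let F : ℕ → Set ChainData := fun n => boundedData ∩ ((⋂ j, {p | Alternating (p.1 j)}) ∩
    ((⋂ j, {p | p.1 j 0 = .D}) ∩ ⋂ (j : ℕ) (_ : j < n),
      ({p | Parse (τ j) (p.1 j) (p.1 (j + 1)) (p.2 j)} ∩ {p | p.2 j 0 = -((τ j : ℕ) : ℤ)})))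
  have hc : ∀ n, IsClosed (F n) := fun n =>
    isCompact_boundedData.isClosed.inter ((isClosed_iInter isClosed_alternating).inter
      ((isClosed_iInter fun j => isClosed_setOf_discrete (continuous_letter j 0) (· = .D)).inter
      (isClosed_iInter fun j => isClosed_iInter fun _ => (isClosed_parse _ _ _).inter
        (isClosed_setOf_discrete (continuous_position j 0) (· = -((τ j : ℕ) : ℤ))))))
  have hne : (⋂ n, F n).Nonempty := by
    refine IsCompact.nonempty_iInter_of_sequence_nonempty_isCompact_isClosed F ?_ ?_
      (isCompact_boundedData.of_isClosed_subset (hc 0) Set.inter_subset_left) hc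
    · intro n p hp
      simp only [F, Set.mem_inter_iff, Set.mem_iInter, Set.mem_ofPred_eq] at hp ⊢
      exact ⟨hp.1, hp.2.1, hp.2.2.1, fun j hj => hp.2.2.2 j (by omega)⟩
    · intro n
      obtain ⟨p, hb, ha, hD, hp⟩ := exists_partial_chain n τ
      refine ⟨p, ?_⟩
      simp only [F, Set.mem_inter_iff, Set.mem_iInter, Set.mem_ofPred_eq]
      exact ⟨hb, ha, hD, hp⟩
  obtain ⟨p, hp⟩ := hne
  simp only [F, Set.mem_inter_iff, Set.mem_iInter, Set.mem_ofPred_eq] at hp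
  exact ⟨p.1, p.2, ⟨(hp 0).2.1, fun n => ((hp (n + 1)).2.2.2 n (by omega)).1⟩, (hp 0).2.2.1,
    fun n => ((hp (n + 1)).2.2.2 n (by omega)).2⟩

theorem isSubshift_Y (τ : ℕ → Fin 2) : IsSubshift (Y τ) := by
  refine ⟨?_, isClosed_Y τ, ?_⟩
  · obtain ⟨y, c, h, -⟩ := exists_chain τ
    exact ⟨y 0, mem_Y_iff.2 ⟨y, c, h, rfl⟩⟩
  · ext z
    constructor
    · rintro ⟨y, hy, rfl⟩
      convert translate_mem_Y hy 1 using 2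
      rw [add_comm]
      rfl
    · intro hz
      refine ⟨_, translate_mem_Y hz (-1), funext fun n => ?_⟩
      simp [shift]

/-! ### Growth of the substitutions -/

/-- The position, at level `0` of a chain, of the letter of index `k` of level `n`. -/
def position (c : ℕ → ℤ → ℤ) : ℕ → ℤ → ℤ
  | 0, k => k
  | n + 1, k => position c n (c n k)

theorem IsChain.position_strictMono {τ : ℕ → Fin 2} {y : ℕ → ℤ → Letter} {c : ℕ → ℤ → ℤ}
    (h : IsChain τ y c) (n : ℕ) : StrictMono (position c n) := by
  induction n with
  | zero => exact strictMono_id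
  | succ n ih => exact ih.comp (strictMono_of_step (h.2 n).lt)

theorem IsChain.position_indices {τ : ℕ → Fin 2} {y : ℕ → ℤ → Letter} {c : ℕ → ℤ → ℤ}
    (h : IsChain τ y c) {q : ℕ → ℤ}
    (hq : ∀ n, c n (q (n + 1)) ≤ q n ∧ q n < c n (q (n + 1) + 1)) (n : ℕ) :
    position c n (q n) ≤ q 0 ∧ q 0 < position c n (q n + 1) := by
  induction n with
  | zero => simp [position]
  | succ n ih =>
    have hm := (h.position_strictMono n).monotone
    have h1 := hm (hq n).1
    have h2 := hm (show q n + 1 ≤ c n (q (n + 1) + 1) from (hq n).2)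
    simp only [position]
    omega

/-- Every interval of at least two letters has an image containing a long letter, so each level down
adds at least 2 letters. -/
theorem IsChain.growth {τ : ℕ → Fin 2} {y : ℕ → ℤ → Letter} {c : ℕ → ℤ → ℤ}
    (h : IsChain τ y c) (n : ℕ) : ∀ a b, a + 2 ≤ b →
      (∃ l, a ≤ l ∧ l < b ∧ (y n l).len = Sym.three) →
      b - a + 2 * n ≤ position c n b - position c n a := by
  induction n with
  | zero => intro a b _ _; simp [position]
  | succ n ih =>
    rintro a b hab ⟨l, hal, hlb, hl⟩
    have hlt := (h.2 n).lt
    have h1 := step_le_sub hlt hal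
    have h2 := step_le_sub hlt (show l + 1 ≤ b from hlb)
    have h3 := (h.2 n).step l
    rw [hl] at h3
    simp only [Sym.val] at h3
    obtain ⟨m, hm, hm', hm3⟩ := h.exists_long n a
    have h4 := step_le_sub hlt hab
    have := ih (c n a) (c n b) (by omega) ⟨m, hm, by omega, hm3⟩
    simp only [position]
    push_cast
    omega

theorem IsChain.growth_pair {τ : ℕ → Fin 2} {y : ℕ → ℤ → Letter} {c : ℕ → ℤ → ℤ}
    (h : IsChain τ y c) (n : ℕ) (k : ℤ) :
    2 * (n : ℤ) ≤ position c (n + 1) (k + 2) - position c (n + 1) k := by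
  -- Two consecutive letters may both be short, but their image one level down contains a long one;
  -- hence the level `n + 1` for a gain of `2 * n`.
  have h4 := step_le_sub (h.2 n).lt (show k ≤ k + 2 by omega)
  have := h.growth n (c n k) (c n (k + 2)) (by omega) (h.exists_long n k)
  simp only [position]
  omega

/-! ### Transfer of words between levels -/

theorem Parse.agree {t : Fin 2} {u v u' v' : ℤ → Letter} {c c' : ℤ → ℤ} (h : Parse t u v c)
    (h' : Parse t u' v' c') {a a' : ℤ} (m : ℕ)
    (hv : ∀ i : ℤ, 0 ≤ i → i < m → v (a + i) = v' (a' + i)) :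
    c' (a' + m) - c' a' = c (a + m) - c a ∧
      ∀ i : ℤ, 0 ≤ i → i < c (a + m) - c a → u (c a + i) = u' (c' a' + i) := by
  induction m with
  | zero => simp; intros; omega
  | succ m ih =>
    obtain ⟨h1, h2⟩ := ih fun i hi hi' => hv i hi (by omega)
    have h3 := h.step (a + m)
    have h4 := h'.step (a' + m)
    have h5 := hv m (by omega) (by omega)
    rw [← h5] at h4
    push_cast
    rw [← add_assoc, ← add_assoc]
    refine ⟨by omega, fun i hi hi' => ?_⟩
    by_cases him : i < c (a + m) - c a
    · exact h2 i hi him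
    · have h6 := h.letter (a + m) (i - (c (a + m) - c a)) (by omega) (by omega)
      have h7 := h'.letter (a' + m) (i - (c (a + m) - c a)) (by omega) (by rw [← h5]; omega)
      rw [← h5, ← h6] at h7
      rw [show c a + i = c (a + m) + (i - (c (a + m) - c a)) by ring, ← h7]
      congr 1
      omega

theorem IsChain.agree {τ : ℕ → Fin 2} {y y' : ℕ → ℤ → Letter} {c c' : ℕ → ℤ → ℤ}
    (h : IsChain τ y c) (h' : IsChain τ y' c') (n : ℕ) : ∀ (a a' : ℤ) (m : ℕ),
      (∀ i : ℤ, 0 ≤ i → i < m → y n (a + i) = y' n (a' + i)) →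
      ∀ i : ℤ, 0 ≤ i → i < position c n (a + m) - position c n a →
        y 0 (position c n a + i) = y' 0 (position c' n a' + i) := by
  induction n with
  | zero => intro a a' m hm i hi hi'; exact hm i hi (by simpa [position] using hi')
  | succ n ih =>
    intro a a' m hm i hi hi'
    obtain ⟨-, h2⟩ := (h.2 n).agree (h'.2 n) m hm
    have h3 := step_le_sub (h.2 n).lt (show a ≤ a + m by omega)
    refine ih (c n a) (c' n a') (c n (a + m) - c n a).toNat (fun j hj hj' => h2 j hj ?_) i hi ?_
    · omega
    · rw [Int.toNat_of_nonneg (by omega), add_sub_cancel]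
      exact hi'

/-- In `φ_t(v)`, the word `φ_t(v k)` and its two neighbouring letters depend only on `v k`. -/
theorem Parse.eq_near {t : Fin 2} {u v : ℤ → Letter} {c : ℤ → ℤ} (h : Parse t u v c)
    (hv : Alternating v) {k j : ℤ} (hj : -1 ≤ j) (hj' : j ≤ (v k).len.val) :
    u (c k + j) = imageLetter t (if j = -1 ∨ j = (v k).len.val then (v k).sym.flip else (v k).sym)
      (if j = -1 ∨ j = (v k).len.val then 0 else j) := by
  have hpos := (v k).len.val_pos
  split_ifs with hc
  · rcases hc with rfl | rfl
    · have h1 := h.step (k - 1)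
      have h2 := hv (k - 1)
      rw [sub_add_cancel] at h1 h2
      have h3 := (v (k - 1)).len.val_pos
      rw [h.eq_of_mem (k := k - 1) (by omega) (by rw [sub_add_cancel]; omega),
        show c k + -1 - c (k - 1) = (v (k - 1)).len.val - 1 by omega, h2, Sym.flip_flip,
        imageLetter, imageLetter, add_zero, ← alternate_alternate, alternate_of_even]
      exact (Sym.val_odd _).sub_odd odd_one
    · rw [← h.step, ← hv]
      simpa using h.letter (k + 1) 0 le_rfl (Sym.val_pos _)
  · exact h.letter k j (by omega) (by omega)

/-- The word `φ_t(v k)` containing the middle letter, extended by one letter on each side, contains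
the triple. -/
theorem Parse.exists_triple {t : Fin 2} {u v u' v' : ℤ → Letter} {c c' : ℤ → ℤ}
    (h : Parse t u v c) (h' : Parse t u' v' c') (hv : Alternating v) (hv' : Alternating v')
    (hall : ∀ a, ∃ k, v' k = a) (a : ℤ) :
    ∃ a', ∀ i : ℤ, 0 ≤ i → i < 3 → u (a + i) = u' (a' + i) := by
  obtain ⟨k, hk, hk'⟩ := exists_block h.lt (a + 1)
  obtain ⟨k', hkk⟩ := hall (v k)
  refine ⟨c' k' + (a - c k), fun i hi hi' => ?_⟩
  have h1 := h.step k
  have e1 := h.eq_near hv (k := k) (j := a + i - c k) (by omega) (by omega)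
  have e2 := h'.eq_near hv' (k := k') (j := a + i - c k) (by omega) (by rw [hkk]; omega)
  rw [hkk, ← e1] at e2
  rw [show a + i = c k + (a + i - c k) by ring, ← e2]
  congr 1
  ring

/-! ### Occurrences of letters -/

theorem Parse.exists_of_D {t : Fin 2} {u v : ℤ → Letter} {c : ℤ → ℤ} (h : Parse t u v c)
    (hD : ∃ k, v k = .D) : (∃ k, u k = .C) ∧ ∃ k, u k = .D := by
  obtain ⟨k, hk⟩ := hD
  have h0 := h.letter k 0 le_rfl (by simp [hk, Letter.len, Sym.val])
  have h1 := h.letter k 1 (by norm_num) (by simp [hk, Letter.len, Sym.val])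
  rw [hk] at h0 h1
  have h01 : t = 0 ∨ t = 1 := by omega
  rcases h01 with rfl | rfl
  · exact ⟨⟨_, h1⟩, ⟨_, h0⟩⟩
  · exact ⟨⟨_, h0⟩, ⟨_, h1⟩⟩

theorem Parse.exists_all {t : Fin 2} {u v : ℤ → Letter} {c : ℤ → ℤ} (h : Parse t u v c)
    (hC : ∃ k, v k = .C) (hD : ∃ k, v k = .D) (a : Letter) : ∃ k, u k = a := by
  obtain ⟨k, hk⟩ := hC
  have h0 := h.letter k 0 le_rfl (by simp [hk, Letter.len, Sym.val])
  have h1 := h.letter k 1 (by norm_num) (by simp [hk, Letter.len, Sym.val])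
  rw [hk] at h0 h1
  have h01 : t = 0 ∨ t = 1 := by omega
  have hCD := h.exists_of_D hD
  rcases h01 with rfl | rfl <;> cases a
  · exact ⟨_, h0⟩
  · exact ⟨_, h1⟩
  · exact hCD.1
  · exact hCD.2
  · exact ⟨_, h1⟩
  · exact ⟨_, h0⟩
  · exact hCD.1
  · exact hCD.2

/-- `φ₀(B)` and `φ₀(D)` start with `D`, so `D` occurs at level `N`. Going down, `φ_t(D)` contains
`C` and `D`, and `φ_t(C)` contains `A` and `B`. -/
theorem IsChain.exists_letter {τ : ℕ → Fin 2} {y : ℕ → ℤ → Letter} {c : ℕ → ℤ → ℤ}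
    (h : IsChain τ y c) {N : ℕ} (hN : τ N = 0) {n : ℕ} (hn : n + 2 ≤ N) (a : Letter) :
    ∃ k, y n k = a := by
  have hD : ∃ k, y N k = .D := by
    obtain ⟨k, -, hk⟩ := (h.1 (N + 1)).exists_sym .three 0
    have := (h.2 N).letter k 0 le_rfl (Sym.val_pos _)
    rw [hN, hk] at this
    exact ⟨_, this⟩
  have hall : ∀ m n, n + m = N → ∃ k, y n k = .D := by
    intro m
    induction m with
    | zero => rintro n rfl; exact hD
    | succ m ih => exact fun n hn => ((h.2 n).exists_of_D (ih (n + 1) (by omega))).2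
  have h1 := (h.2 (n + 1)).exists_of_D (hall (N - (n + 2)) (n + 2) (by omega))
  exact (h.2 n).exists_all h1.1 h1.2 a

theorem IsChain.exists_word {τ : ℕ → Fin 2} (hτ : {n : ℕ | τ n = 0}.Infinite)
    {y y' : ℕ → ℤ → Letter} {c c' : ℕ → ℤ → ℤ} (h : IsChain τ y c) (h' : IsChain τ y' c')
    (p : ℤ) (L : ℕ) : ∃ p', ∀ i : ℤ, 0 ≤ i → i < L → y 0 (p + i) = y' 0 (p' + i) := by
  obtain ⟨N, hN, hNL⟩ := hτ.exists_gt (L + 4)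
  obtain ⟨q, rfl, hq⟩ := h.exists_indices p
  have hb := h.position_indices hq (L + 1)
  -- The window starts in the image of the letter `q (L + 1)`; the images of the next two letters
  -- leave room for its `L` letters.
  have hg := h.growth_pair L (q (L + 1) + 1)
  obtain ⟨a', ha'⟩ := (h.2 (L + 1)).exists_triple (h'.2 (L + 1)) (h.1 _) (h'.1 _)
    (h'.exists_letter hN (by omega)) (q (L + 1))
  have := h.agree h' (L + 1) _ a' 3 (fun i hi hi' => ha' i hi hi')
  rw [add_assoc] at hg
  norm_num at hg this
  refine ⟨position c' (L + 1) a' + (q 0 - position c (L + 1) (q (L + 1))), fun i hi hi' => ?_⟩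
  have e := this (q 0 - position c (L + 1) (q (L + 1)) + i) (by omega) (by omega)
  rw [← add_assoc, add_sub_cancel, ← add_assoc] at e
  exact e

/-- If only the substitution `φ₁` is used from level `N` on, then `D` occurs at most once at
level `N`. -/
theorem IsChain.D_unique {τ : ℕ → Fin 2} {y : ℕ → ℤ → Letter} {c : ℕ → ℤ → ℤ}
    (h : IsChain τ y c) {N : ℕ} (hN : ∀ n, N ≤ n → τ n = 1) {i j : ℤ} (hi : y N i = .D)
    (hj : y N j = .D) : i = j := by
  have pre : ∀ n, N ≤ n → ∀ i, y n i = .D → ∃ k, i = c n k + 1 ∧ y (n + 1) k = .D := by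
    intro n hn i hi
    obtain ⟨k, hk, hk'⟩ := exists_block (h.2 n).lt i
    have e := (h.2 n).eq_of_mem hk hk'
    have hs := (h.2 n).step k
    have hl := (y (n + 1) k).len.val_eq
    rw [hi, hN n hn] at e
    have e1 := congrArg Letter.len e
    rw [imageLetter, len_code] at e1
    have e2 := congrArg Letter.sym e
    rw [imageLetter, sym_code, ← e1] at e2
    have hne : i - c n k ≠ 0 ∧ i - c n k ≠ 2 := by
      constructor <;> intro h0 <;> rw [h0, alternate_of_odd _ (by decide)] at e2 <;> revert e2 <;>
        simp [Letter.sym, Letter.len, Sym.flip]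
    refine ⟨k, by omega, Letter.ext_sym_len e1.symm ?_⟩
    have : (y (n + 1) k).len.val = 3 := by omega
    revert this
    cases (y (n + 1) k).len <;> simp [Sym.val, Letter.len]
  -- Descent on the distance: the preimages of two `D`s are strictly closer, since the first one
  -- contributes a word of size 3.
  have key : ∀ (d : ℕ) (n : ℕ), N ≤ n → ∀ i j, y n i = .D → y n j = .D → i < j → j - i ≤ d →
      False := by
    intro d
    induction d with
    | zero => intros; push_cast at *; omega
    | succ d ih =>
      intro n hn i j hi hj hij hd
      obtain ⟨k, rfl, hk⟩ := pre n hn i hi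
      obtain ⟨l, rfl, hl⟩ := pre n hn j hj
      have hm := strictMono_of_step (h.2 n).lt
      have hkl : k < l := hm.lt_iff_lt.1 (by omega)
      have h1 := (h.2 n).step k
      rw [hk] at h1
      have h2 := step_le_sub (h.2 n).lt (show k + 1 ≤ l from hkl)
      simp only [Letter.len, Sym.val] at h1
      push_cast at hd
      exact ih (n + 1) (by omega) k l hk hl hkl (by omega)
  rcases lt_trichotomy i j with hij | hij | hij
  · exact (key (j - i).toNat N le_rfl i j hi hj hij (by omega)).elim
  · exact hij
  · exact (key (i - j).toNat N le_rfl j i hj hi hij (by omega)).elim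

/-! ### Subshifts over the recoding alphabet -/

theorem IsSubshift.translate {α : Type*} [TopologicalSpace α] {Z : Set (ℤ → α)}
    (hZ : IsSubshift Z) {z : ℤ → α} (hz : z ∈ Z) (p : ℤ) : (fun i => z (p + i)) ∈ Z := by
  have h1 : ∀ z ∈ Z, (fun i => z (1 + i)) ∈ Z := fun z hz => by
    rw [← hZ.2.2]
    exact ⟨z, hz, funext fun n => congrArg z (add_comm n 1)⟩
  have h2 : ∀ z ∈ Z, (fun i => z (-1 + i)) ∈ Z := fun z hz => by
    rw [← hZ.2.2] at hz
    obtain ⟨y, hy, rfl⟩ := hz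
    simpa [shift, add_comm, add_left_comm] using hy
  induction p using Int.induction_on with
  | zero => simpa using hz
  | succ i ih =>
    convert h1 _ ih using 2
    ring_nf
  | pred i ih =>
    convert h2 _ ih using 2
    ring_nf

theorem iterate_shift {α : Type*} (z : ℤ → α) (n : ℕ) : shift^[n] z = fun i => z (n + i) := by
  induction n with
  | zero => simp
  | succ n ih =>
    rw [Function.iterate_succ_apply', ih]
    funext i
    simp only [shift]
    congr 1
    push_cast
    ring

theorem isClopen_cylinder (w : List Letter) : IsClopen (cylinder w) := by
  have : cylinder w = ⋂ i : Fin w.length, (fun y : ℤ → Letter => y ((i : ℕ) : ℤ)) ⁻¹' {w.get i} := by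
    ext y
    simp [cylinder]
  rw [this]
  exact isClopen_iInter_of_finite fun i => (isClopen_discrete _).preimage (continuous_apply _)

theorem measurableSet_cylinder (w : List Letter) : MeasurableSet (cylinder w) := by
  have : cylinder w = ⋂ i : Fin w.length, (fun y : ℤ → Letter => y ((i : ℕ) : ℤ)) ⁻¹' {w.get i} := by
    ext y
    simp [cylinder]
  rw [this]
  exact MeasurableSet.iInter fun i => measurable_pi_apply _ MeasurableSpace.measurableSet_top

theorem continuous_translate (p : ℤ) : Continuous fun (z : ℤ → Letter) i => z (p + i) :=
  continuous_pi fun _ => continuous_apply _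

theorem measurable_translate (p : ℤ) : Measurable fun (z : ℤ → Letter) i => z (p + i) :=
  measurable_pi_lambda _ fun _ => measurable_pi_apply _

/-- A point outside a closed set has a window that no element of the set shares. -/
theorem exists_window_notMem {F : Set (ℤ → Letter)} (hF : IsClosed F) {z : ℤ → Letter}
    (hz : z ∉ F) : ∃ m : ℕ, ∀ z' : ℤ → Letter, (∀ i : ℤ, -m ≤ i → i ≤ m → z' i = z i) → z' ∉ F := by
  obtain ⟨I, u, hu, hs⟩ := isOpen_pi_iff.1 hF.isOpen_compl z hz
  refine ⟨I.sup Int.natAbs, fun z' hz' => hs fun i hi => ?_⟩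
  have := Finset.le_sup (f := Int.natAbs) hi
  rw [hz' i (by omega) (by omega)]
  exact (hu i hi).2

theorem mem_cylinder_of_agree {w : List Letter} {z z' : ℤ → Letter} (hz : z ∈ cylinder w)
    (h : ∀ i : ℤ, 0 ≤ i → i < w.length → z i = z' i) : z' ∈ cylinder w := fun i => by
  rw [← hz i]
  exact (h i (by omega) (by omega)).symm

/-- Every word of every element of `Z` occurs in every element of `Z`. -/
def SharesWords (Z : Set (ℤ → Letter)) : Prop :=
  ∀ y ∈ Z, ∀ z ∈ Z, ∀ (p : ℤ) (L : ℕ), ∃ p' : ℤ, ∀ i : ℤ, 0 ≤ i → i < L → y (p + i) = z (p' + i)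

theorem SharesWords.isMinimalSubshift {Z : Set (ℤ → Letter)} (h : SharesWords Z)
    (hZ : IsSubshift Z) : IsMinimalSubshift Z := by
  refine ⟨hZ, fun W hW hWZ => hWZ.antisymm fun z hz => ?_⟩
  by_contra hzW
  obtain ⟨m, hm⟩ := exists_window_notMem hW.2.1 hzW
  obtain ⟨y, hy⟩ := hW.1
  obtain ⟨p', hp'⟩ := h z hz y (hWZ hy) (-m) (2 * m + 1)
  refine hm _ (fun i hi hi' => ?_) (hW.translate hy (p' + m))
  have := hp' (i + m) (by omega) (by push_cast; omega)
  rw [neg_add_cancel_comm_assoc] at this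
  rw [this]
  congr 1
  ring

theorem IsInvariantProbability.measure_translate {Z : Set (ℤ → Letter)}
    {ν : Measure (ℤ → Letter)} (hν : IsInvariantProbability Z ν) {s : Set (ℤ → Letter)}
    (hs : MeasurableSet s) (p : ℤ) : ν ((fun z i => z (p + i)) ⁻¹' s) = ν s := by
  have step : ∀ p : ℤ, ν ((fun z i => z (p + 1 + i)) ⁻¹' s) = ν ((fun z i => z (p + i)) ⁻¹' s) := by
    intro p
    rw [← hν.2.2.measure_preimage (measurable_translate p hs).nullMeasurableSet,
      ← Set.preimage_comp]
    congr 2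
    funext z i
    simp only [shift, Function.comp]
    congr 1
    ring
  induction p using Int.induction_on with
  | zero => simp
  | succ i ih => rw [step, ih]
  | pred i ih => rw [← step, sub_add_cancel, ih]

/-- The countably many translates of the cylinder cover `Z` and have equal measure. -/
theorem SharesWords.measure_pos {Z : Set (ℤ → Letter)} (h : SharesWords Z)
    {ν : Measure (ℤ → Letter)} (hν : IsInvariantProbability Z ν) {w : List Letter}
    (hw : w ∈ language Z) : 0 < ν (cylinder w) := by
  have := hν.1
  rw [pos_iff_ne_zero]
  intro h0
  obtain ⟨y, hy, j, hj⟩ := hw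
  have hcov : Z ⊆ ⋃ p : ℤ, (fun z i => z (p + i)) ⁻¹' cylinder w := by
    intro z hz
    obtain ⟨p, hp⟩ := h y hy z hz j w.length
    exact Set.mem_iUnion.2 ⟨p, mem_cylinder_of_agree (z := fun i => y (j + i)) hj hp⟩
  have hZ : ν Z = 0 := measure_mono_null hcov (measure_iUnion_null fun p => by
    rw [hν.measure_translate (measurableSet_cylinder w), h0])
  have : ν Set.univ = 0 := by
    rw [← Set.union_compl_self Z]
    exact measure_union_null hZ hν.2.1
  simp at this

/-- The word `w` has no occurrence far to the right in any element of `Z`. -/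
def EventuallyAvoids (Z : Set (ℤ → Letter)) (w : List Letter) : Prop :=
  ∀ z ∈ Z, ∃ M : ℤ, ∀ p, M ≤ p → (fun i => z (p + i)) ∉ cylinder w

/-- By Poincaré recurrence, almost every point of the cylinder returns to it infinitely often. -/
theorem EventuallyAvoids.measure_eq_zero {Z : Set (ℤ → Letter)} {w : List Letter}
    (h : EventuallyAvoids Z w) {ν : Measure (ℤ → Letter)} (hν : IsInvariantProbability Z ν) :
    ν (cylinder w) = 0 := by
  have := hν.1
  have hrec := hν.2.2.conservative.ae_mem_imp_frequently_image_mem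
    (measurableSet_cylinder w).nullMeasurableSet
  have hZ : ∀ᵐ z ∂ν, z ∈ Z := hν.2.1
  rw [measure_eq_zero_iff_ae_notMem]
  filter_upwards [hrec, hZ] with z hz hzZ hzw
  obtain ⟨M, hM⟩ := h z hzZ
  obtain ⟨n, hn, hn'⟩ := Filter.frequently_atTop.1 (hz hzw) M.toNat
  rw [iterate_shift] at hn'
  exact hM n (by omega) hn'

theorem EventuallyAvoids.not_isMinimalSubshift {Z : Set (ℤ → Letter)} {w : List Letter}
    (h : EventuallyAvoids Z w) (hZ : IsSubshift Z) (hw : w ∈ language Z) :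
    ¬ IsMinimalSubshift Z := by
  intro hmin
  let F : ℤ → Set (ℤ → Letter) := fun p => {z | (fun i => z (p + i)) ∉ cylinder w}
  have hF : ∀ p, IsClosed (F p) := fun p =>
    ((isClopen_cylinder w).isOpen.preimage (continuous_translate p)).isClosed_compl
  -- Shifting a point far enough removes `w` from all positions `≥ -n`; by compactness some point
  -- avoids `w` everywhere, and such points form a proper subshift.
  have hne : (⋂ n : ℕ, Z ∩ ⋂ (p : ℤ) (_ : -(n : ℤ) ≤ p), F p).Nonempty := by
    have hc : ∀ n : ℕ, IsClosed (Z ∩ ⋂ (p : ℤ) (_ : -(n : ℤ) ≤ p), F p) := fun n =>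
      hZ.2.1.inter (isClosed_iInter fun p => isClosed_iInter fun _ => hF p)
    refine IsCompact.nonempty_iInter_of_sequence_nonempty_isCompact_isClosed _ ?_ ?_
      (hc 0).isCompact hc
    · intro n z hz
      simp only [Set.mem_inter_iff, Set.mem_iInter] at hz ⊢
      exact ⟨hz.1, fun p hp => hz.2 p (by push_cast; omega)⟩
    · intro n
      obtain ⟨z, hz⟩ := hZ.1
      obtain ⟨M, hM⟩ := h z hz
      refine ⟨_, hZ.translate hz (M + n), ?_⟩
      simp only [Set.mem_iInter]
      intro p hp
      have := hM (M + n + p) (by omega)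
      simp only [F, Set.mem_ofPred_eq, ← add_assoc]
      exact this
  have hsub : IsSubshift (Z ∩ ⋂ p : ℤ, F p) := by
    refine ⟨?_, hZ.2.1.inter (isClosed_iInter hF), ?_⟩
    · obtain ⟨z, hz⟩ := hne
      simp only [Set.mem_inter_iff, Set.mem_iInter] at hz
      exact ⟨z, (hz 0).1, Set.mem_iInter.2 fun p => (hz p.natAbs).2 p (by omega)⟩
    · have key : ∀ (q : ℤ) (z : ℤ → Letter), z ∈ Z ∩ ⋂ p : ℤ, F p →
          (fun i => z (q + i)) ∈ Z ∩ ⋂ p : ℤ, F p := by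
        intro q z hz
        refine ⟨hZ.translate hz.1 q, Set.mem_iInter.2 fun p => ?_⟩
        have := Set.mem_iInter.1 hz.2 (q + p)
        simp only [F, Set.mem_ofPred_eq, ← add_assoc] at this ⊢
        exact this
      ext z
      constructor
      · rintro ⟨y, hy, rfl⟩
        convert key 1 y hy using 1
        funext i
        simp [shift, add_comm]
      · intro hz
        exact ⟨_, key (-1) z hz, by funext i; simp [shift]⟩
  have heq := hmin.2 _ hsub Set.inter_subset_left
  obtain ⟨y, hy, j, hj⟩ := hw
  rw [← heq] at hy
  exact Set.mem_iInter.1 hy.2 j hj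

/-! ### The subshifts `Y_τ` -/

theorem sharesWords_Y {τ : ℕ → Fin 2} (hτ : {n : ℕ | τ n = 0}.Infinite) : SharesWords (Y τ) := by
  intro y hy z hz p L
  obtain ⟨u, c, hu, rfl⟩ := mem_Y_iff.1 hy
  obtain ⟨v, d, hv, rfl⟩ := mem_Y_iff.1 hz
  exact hu.exists_word hτ hv p L

/-- If only the substitution `φ₁` is used from level `N` on, some word marks the occurrence of the
image of the letter `D` of level `N`. -/
theorem exists_eventuallyAvoids {τ : ℕ → Fin 2} {N : ℕ} (hN : ∀ n, N ≤ n → τ n = 1) :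
    ∃ w ∈ language (Y τ), EventuallyAvoids (Y τ) w := by
  obtain ⟨y, c, hy, hD, -⟩ := exists_chain τ
  -- The points with a letter other than `D` at the origin of level `N` form a closed set missing `y
  -- 0`, so a window of `y 0` forces `D` there.
  have hF : IsClosed (⋃ a : {a : Letter // a ≠ .D}, levelCylinder τ N a) :=
    isClosed_iUnion_of_finite fun a => isClosed_levelCylinder τ N a
  have hyF : y 0 ∉ ⋃ a : {a : Letter // a ≠ .D}, levelCylinder τ N a := by
    intro hmem
    obtain ⟨⟨a, ha⟩, y', c', hy', h0, hN'⟩ := Set.mem_iUnion.1 hmem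
    rw [hy'.unique hy h0, hD] at hN'
    exact ha hN'.symm
  obtain ⟨m, hm⟩ := exists_window_notMem hF hyF
  refine ⟨List.ofFn fun i : Fin (2 * m + 1) => y 0 (-m + (i : ℕ)),
    ⟨y 0, mem_Y_iff.2 ⟨y, c, hy, rfl⟩, -m, fun i => by rw [List.get_ofFn]; rfl⟩, ?_⟩
  intro z hz
  obtain ⟨z, d, hc, rfl⟩ := mem_Y_iff.1 hz
  have key : ∀ p, (fun i => z 0 (p + i)) ∈ cylinder
      (List.ofFn fun i : Fin (2 * m + 1) => y 0 (-m + (i : ℕ))) →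
      ∃ k, z N k = .D ∧ p + m < position d N (k + 1) := by
    intro p hp
    have hYp := translate_mem_Y hz (p + m)
    have hFp := hm (fun i => z 0 (p + m + i)) fun i hi hi' => by
      have := hp ⟨(i + m).toNat, by simp; omega⟩
      simp only [List.get_ofFn] at this
      simp only [Fin.cast_mk] at this
      rw [Int.toNat_of_nonneg (by omega), neg_add_cancel_comm_assoc] at this
      rw [← this]
      congr 1
      ring
    rw [Y_eq_iUnion_levelCylinder τ N] at hYp
    obtain ⟨a, ha⟩ := Set.mem_iUnion.1 hYp
    have haD : a = .D := by
      by_contra hne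
      exact hFp (Set.mem_iUnion.2 ⟨⟨a, hne⟩, ha⟩)
    obtain ⟨y', c', hy', h0, hN'⟩ := ha
    obtain ⟨q, hq0, hq⟩ := hc.exists_indices (p + m)
    have hq1 := (hc.position_indices hq N).2
    have := hy'.unique (hc.translate hq) (by rw [h0, hq0])
    rw [this, haD] at hN'
    simp only [add_zero] at hN'
    exact ⟨q N, hN', by rw [← hq0]; exact hq1⟩
  by_cases hex : ∃ k, z N k = .D
  · obtain ⟨k, hk⟩ := hex
    refine ⟨position d N (k + 1) - m, fun p hp hmem => ?_⟩
    obtain ⟨l, hl, hpl⟩ := key p hmem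
    rw [hc.D_unique hN hl hk] at hpl
    omega
  · refine ⟨0, fun p _ hmem => hex ?_⟩
    obtain ⟨l, hl, -⟩ := key p hmem
    exact ⟨l, hl⟩

theorem exists_eventuallyAvoids_of_finite {τ : ℕ → Fin 2} (hτ : {n : ℕ | τ n = 0}.Finite) :
    ∃ w ∈ language (Y τ), EventuallyAvoids (Y τ) w := by
  obtain ⟨N, hN⟩ := hτ.bddAbove
  refine exists_eventuallyAvoids (N := N + 1) fun n hn => ?_
  by_contra h
  have : n ≤ N := hN (show τ n = 0 by omega)
  omega

theorem eventuallyAvoids_D : EventuallyAvoids (Y fun _ => 1) [Letter.D] := by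
  intro z hz
  obtain ⟨y, c, h, rfl⟩ := mem_Y_iff.1 hz
  have hmem : ∀ p, (fun i => y 0 (p + i)) ∈ cylinder [Letter.D] → y 0 p = .D := fun p hp => by
    simpa using hp ⟨0, by simp⟩
  by_cases hex : ∃ k, y 0 k = .D
  · obtain ⟨k, hk⟩ := hex
    refine ⟨k + 1, fun p hp hp' => ?_⟩
    have := h.D_unique (N := 0) (fun _ _ => rfl) (hmem p hp') hk
    omega
  · exact ⟨0, fun p _ hp => hex ⟨p, hmem p hp⟩⟩

/-! ### The fixed point -/

theorem subst_spec (t : Fin 2) (a : Letter) : ((subst t a).length : ℤ) = a.len.val ∧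
    ∀ i : Fin (subst t a).length, (subst t a).get i = imageLetter t a.sym (i : ℕ) := by
  have h01 : t = 0 ∨ t = 1 := by omega
  rcases h01 with rfl | rfl <;> cases a <;> refine ⟨rfl, fun i => ?_⟩ <;> fin_cases i <;> rfl

theorem Parse.isSubstImage {t : Fin 2} {u v : ℤ → Letter} {c : ℤ → ℤ} (h : Parse t u v c) :
    IsSubstImage t v fun i => u (c 0 + i) := by
  refine ⟨fun k => c k - c 0, by simp, fun k => ⟨?_, fun i => ?_⟩⟩
  · beta_reduce
    rw [(subst_spec t _).1, h.step]
    ring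
  · rw [(subst_spec t _).2, ← h.letter k (i : ℕ) (by omega)
      (by rw [← (subst_spec t _).1]; exact_mod_cast i.2)]
    beta_reduce
    congr 1
    ring

/-- Agreement on `[-m, m]` one level up gives agreement on `[-m-1, m+1]`, because the central `φ₁(D)
= CDC` covers `-1, 0, 1`. -/
theorem IsChain.level_eq {y : ℕ → ℤ → Letter} {c : ℕ → ℤ → ℤ} (h : IsChain (fun _ => 1) y c)
    (hD : ∀ n, y n 0 = .D) (hc : ∀ n, c n 0 = -1) (n n' : ℕ) : y n = y n' := by
  have key : ∀ (m : ℕ) (n n' : ℕ) (i : ℤ), -m ≤ i → i ≤ m → y n i = y n' i := by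
    intro m
    induction m with
    | zero =>
      intro n n' i hi hi'
      obtain rfl : i = 0 := by push_cast at *; omega
      rw [hD, hD]
    | succ m ih =>
      intro n n' i hi hi'
      push_cast at hi hi'
      have hag : ∀ j : ℤ, 0 ≤ j → j < (2 * m + 1 : ℕ) →
          y (n + 1) (-m + j) = y (n' + 1) (-m + j) := fun j hj hj' =>
        ih _ _ _ (by omega) (by push_cast at hj'; omega)
      -- The `m` letters left of the origin have images of equal total size, so the cuts `c n (-m)`
      -- and `c n' (-m)` coincide.
      have h1 := ((h.2 n).agree (h.2 n') m fun j hj hj' => hag j hj (by push_cast; omega)).1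
      have h2 := ((h.2 n).agree (h.2 n') (2 * m + 1) hag).2
      rw [neg_add_cancel, hc, hc] at h1
      have e : c n' (-m) = c n (-m) := by omega
      have hs := (h.2 n).step 0
      rw [zero_add, hc, hD] at hs
      simp only [Letter.len, Sym.val] at hs
      have hl := step_le_sub (h.2 n).lt (show (-m : ℤ) ≤ 0 by omega)
      have hr := step_le_sub (h.2 n).lt (show (1 : ℤ) ≤ m + 1 by omega)
      rw [hc] at hl
      have := h2 (i - c n (-m)) (by omega) (by
        rw [show (-m : ℤ) + ((2 * m + 1 : ℕ) : ℤ) = m + 1 by push_cast; ring]; omega)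
      rwa [e, add_sub_cancel] at this
  funext i
  exact key i.natAbs n n' i (by omega) (by omega)

theorem exists_fixedPoint : ∃ y ∈ Y (fun _ => 1),
    (∃ z, IsSubstImage 1 y z ∧ shift z = y) ∧ ∀ n : ℤ, y n = Letter.D ↔ n = 0 := by
  obtain ⟨y, c, h, hD, hc⟩ := exists_chain fun _ => 1
  have hc : ∀ n, c n 0 = -1 := fun n => by simpa using hc n
  -- The central word starts at `-1`, so starting it at `0` displaces the sequence by one place,
  -- which `shift` undoes.
  refine ⟨y 0, mem_Y_iff.2 ⟨y, c, h, rfl⟩, ⟨fun i => y 0 (c 0 0 + i), ?_, ?_⟩,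
    fun n => ⟨fun hn => ?_, ?_⟩⟩
  · have := (h.2 0).isSubstImage
    rwa [h.level_eq hD hc (0 + 1) 0] at this
  · funext i
    simp [shift, hc]
  · exact h.D_unique (N := 0) (fun _ _ => rfl) hn (hD 0)
  · rintro rfl
    exact hD 0

end SmoothSeq

theorem theorem4p4 :
    (∀ τ : ℕ → Fin 2,
      -- `Y_τ` is a subshift, and it is minimal iff `τ` contains infinitely many zeros
      SmoothSeq.IsSubshift (SmoothSeq.Y τ) ∧
      (SmoothSeq.IsMinimalSubshift (SmoothSeq.Y τ) ↔ {n : ℕ | τ n = 0}.Infinite) ∧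
      -- infinitely many zeros: the invariant measure charges every word of the language
      ({n : ℕ | τ n = 0}.Infinite →
        ∀ ν : MeasureTheory.Measure (ℤ → SmoothSeq.Letter),
          SmoothSeq.IsInvariantProbability (SmoothSeq.Y τ) ν →
          ∀ w ∈ SmoothSeq.language (SmoothSeq.Y τ), 0 < ν (SmoothSeq.cylinder w)) ∧
      -- finitely many zeros: some word of the language has measure zero
      ({n : ℕ | τ n = 0}.Finite →
        ∃ w ∈ SmoothSeq.language (SmoothSeq.Y τ),
          ∀ ν : MeasureTheory.Measure (ℤ → SmoothSeq.Letter),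
            SmoothSeq.IsInvariantProbability (SmoothSeq.Y τ) ν →
            ν (SmoothSeq.cylinder w) = 0)) ∧
    -- the case `τ = 1^∞`: a fixed point of `S ∘ φ₁` with exactly one `D`, and `ν([D]) = 0`
    (∃ y ∈ SmoothSeq.Y (fun _ => 1),
      (∃ z, SmoothSeq.IsSubstImage 1 y z ∧ SmoothSeq.shift z = y) ∧
      ∀ n : ℤ, y n = SmoothSeq.Letter.D ↔ n = 0) ∧
    (∀ ν : MeasureTheory.Measure (ℤ → SmoothSeq.Letter),
      SmoothSeq.IsInvariantProbability (SmoothSeq.Y (fun _ => 1)) ν →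
      ν (SmoothSeq.cylinder [SmoothSeq.Letter.D]) = 0) := by
  refine ⟨fun τ => ⟨SmoothSeq.isSubshift_Y τ, ⟨fun h hfin => ?_, fun h =>
    (SmoothSeq.sharesWords_Y h).isMinimalSubshift (SmoothSeq.isSubshift_Y τ)⟩,
    fun h ν hν w hw => (SmoothSeq.sharesWords_Y h).measure_pos hν hw, fun h => ?_⟩,
    SmoothSeq.exists_fixedPoint, fun ν hν => SmoothSeq.eventuallyAvoids_D.measure_eq_zero hν⟩
  · obtain ⟨w, hw, ha⟩ := SmoothSeq.exists_eventuallyAvoids_of_finite hfin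
    exact ha.not_isMinimalSubshift (SmoothSeq.isSubshift_Y τ) hw h
  · obtain ⟨w, hw, ha⟩ := SmoothSeq.exists_eventuallyAvoids_of_finite h
    exact ⟨w, hw, fun ν hν => ha.measure_eq_zero hν⟩
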